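/- Let $0<\alpha\le\pi/4$. A drone moves in the closed upper half-plane, starting at $P_0=(0,0)$; at position $(t_x,t_y)$, $t_y\ge 0$, it covers the points $(x,0)$ with $t_x-t_y\tan\alpha\le x\le t_x+t_y\tan\alpha$. Requests $X_i=(x_i,0)$ arrive one at a time, with $x_0=0$. After each request $X_i$ the drone must move to a point $P_i$ that covers all of $X_0,\dots,X_i$; the cost of positions $P_0,\dots,P_n$ is $\sum_{i<n}|P_iP_{i+1}|$. A deterministic online algorithm $\mathrm{ALG}$ chooses $P_i$ as a function of $x_1,\dots,x_i$ only. $\mathrm{OPT}(X)$ is the least cost of a sequence of positions that serves $X$ in this way, when the whole of $X$ is known in advance. The competitive ratio $\rho(\mathrm{ALG};\alpha)$ is the supremum of $\mathrm{ALG}(X)/\mathrm{OPT}(X)$ over all finite request sequences $X$ with $\mathrm{OPT}(X)>0$. Put $$h=\sqrt[3]{-108\cos^2(4\alpha)+\sqrt{(108-108\cos^2(4\alpha))^2-4(12\cos(4\alpha)-12)^3}+108},$$ $$R=\cos^2(4\alpha)-\frac{8\sqrt[3]{2}\,\sin^2(2\alpha)}{h}+\frac{h}{3\sqrt[3]{2}},$$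 $$s^*=-\tfrac12\cos(4\alpha)+\tfrac12\sqrt{R}+\tfrac12\sqrt{2\cos^2(4\alpha)+\frac{8\sqrt[3]{2}\,\sin^2(2\alpha)}{h}+\frac{16-8\cos^3(4\alpha)}{4\sqrt{R}}-\frac{h}{3\sqrt[3]{2}}},$$ $$\rho^*=\frac{s^*(1+s^*)\sqrt{1-\cos(4\alpha)}}{\sqrt{2(1+(s^*)^4)-4(s^*)^2\cos(4\alpha)}}.$$ Then $s^*>1$, and $s^*$ is the only root $s\ge 1$ of $s^4+2s^3\cos(4\alpha)-2s-1=0$. Every deterministic online algorithm $\mathrm{ALG}$ satisfies $\rho(\mathrm{ALG};\alpha)\ge\rho^*$. Moreover, this bound is already forced by the prefixes of the single infinite request sequence $x_i=2(-s^*)^{i-1}$, $i\ge1$: the supremum over $n\ge1$ of the ratio $\mathrm{ALG}(X)/\mathrm{OPT}(X)$ for $X=(x_1,\dots,x_n)$ is at least $\rho^*$. -/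

import Mathlib

noncomputable section

namespace DroneCoverage

/-- The Euclidean plane; `P 0` is the horizontal coordinate and `P 1` the height. -/
abbrev Plane : Type := EuclideanSpace ℝ (Fin 2)

/-- A drone at `P`, with half-angle of view `α`, covers the point `(x, 0)`: it is not below the
ground, and `x` lies in `[P 0 - P 1 * tan α, P 0 + P 1 * tan α]`. -/
def Covers (α : ℝ) (P : Plane) (x : ℝ) : Prop :=
  0 ≤ P 1 ∧ P 0 - P 1 * Real.tan α ≤ x ∧ x ≤ P 0 + P 1 * Real.tan α

/-- The total length of the polygonal path `P 0, P 1, …, P n`. -/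
def pathLength (n : ℕ) (P : ℕ → Plane) : ℝ :=
  ∑ i ∈ Finset.range n, dist (P i) (P (i + 1))

/-- An input is the list `[x₁, …, xₙ]` of requests that follow the initial request `x₀ = 0`.
A solution is a sequence `P 0, …, P n` of positions that starts at the origin and such that
`P i` covers `x₀, x₁, …, xᵢ` (the values `P i` with `i > n` play no role). -/
def IsSolution (α : ℝ) (X : List ℝ) (P : ℕ → Plane) : Prop :=
  P 0 = 0 ∧ ∀ i ≤ X.length, ∀ x ∈ (0 : ℝ) :: X.take i, Covers α (P i) x

/-- The optimal offline cost: the least length of a solution, the whole input being known. -/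
def opt (α : ℝ) (X : List ℝ) : ℝ :=
  sInf {c : ℝ | ∃ P : ℕ → Plane, IsSolution α X P ∧ c = pathLength X.length P}

/-- A deterministic online algorithm: the position of the drone after the requests `x₁, …, xᵢ`
is a function of the list `[x₁, …, xᵢ]` only; the drone starts at the origin and always covers
all the requests revealed so far, `x₀ = 0` included. -/
structure OnlineAlgorithm (α : ℝ) where
  pos : List ℝ → Plane
  pos_nil : pos [] = 0
  covers : ∀ (X : List ℝ), ∀ x ∈ (0 : ℝ) :: X, Covers α (pos X) x

/-- The cost of an online algorithm on the input `X`. -/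
def OnlineAlgorithm.cost {α : ℝ} (A : OnlineAlgorithm α) (X : List ℝ) : ℝ :=
  pathLength X.length (fun i => A.pos (X.take i))

/-- The worst-case ratio of the cost of the algorithm to the optimal offline cost, over the
inputs in `S` with nonzero optimal cost (those with a request that is not at the origin). -/
def OnlineAlgorithm.competitiveRatioOn {α : ℝ} (A : OnlineAlgorithm α) (S : Set (List ℝ)) :
    EReal :=
  ⨆ X ∈ S, ⨆ _ : 0 < opt α X, ((A.cost X / opt α X : ℝ) : EReal)

/-- The competitive ratio: the worst-case ratio over all inputs. -/
def OnlineAlgorithm.competitiveRatio {α : ℝ} (A : OnlineAlgorithm α) : EReal :=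
  A.competitiveRatioOn Set.univ

/-- The first `n` requests `xᵢ = 2 (-s) ^ (i - 1)`, `i = 1, …, n`, of the adversary. -/
def adversary (s : ℝ) (n : ℕ) : List ℝ :=
  (List.range n).map (fun k => 2 * (-s) ^ k)

/-- The cube root of two. -/
def cbrtTwo : ℝ := (2 : ℝ) ^ ((1 : ℝ) / 3)

/-- The auxiliary quantity `h` in the closed form of `s*`. -/
def hAux (α : ℝ) : ℝ :=
  (-108 * Real.cos (4 * α) ^ 2
    + Real.sqrt ((108 - 108 * Real.cos (4 * α) ^ 2) ^ 2 - 4 * (12 * Real.cos (4 * α) - 12) ^ 3)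
    + 108) ^ ((1 : ℝ) / 3)

/-- The radicand that occurs twice in the closed form of `s*`. -/
def radicand (α : ℝ) : ℝ :=
  Real.cos (4 * α) ^ 2 - 8 * cbrtTwo * Real.sin (2 * α) ^ 2 / hAux α + hAux α / (3 * cbrtTwo)

/-- The ratio `s*` of the adversary's geometric sequence, in closed form. -/
def sStar (α : ℝ) : ℝ :=
  -(1 / 2) * Real.cos (4 * α) + 1 / 2 * Real.sqrt (radicand α)
    + 1 / 2 * Real.sqrt (2 * Real.cos (4 * α) ^ 2
        + 8 * cbrtTwo * Real.sin (2 * α) ^ 2 / hAux α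
        + (16 - 8 * Real.cos (4 * α) ^ 3) / (4 * Real.sqrt (radicand α))
        - hAux α / (3 * cbrtTwo))

/-- The lower bound `ρ*`. -/
def rhoStar (α : ℝ) : ℝ :=
  sStar α * (1 + sStar α) * Real.sqrt (1 - Real.cos (4 * α))
    / Real.sqrt (2 * (1 + sStar α ^ 4) - 4 * sStar α ^ 2 * Real.cos (4 * α))

end DroneCoverage

end

namespace DroneCoverage

open Real

/-! Let `Q n` be the drone's position after `n` requests, `L n` the length travelled, and `s > 1`
any ratio. Covering request `n + 1` puts `Q (n + 1)` in a half-plane whose side alternates with `n`.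
Reflect a fixed unit vector `(a, b)` along with the side, and subtract from `L (n + 1)` the
component of `Q (n + 1)` along it. If `L` is at most `M * s ^ n`, this potential, divided by `s ^ (n
+ 1)`, grows by a fixed amount per step unless `M` is large; yet it is at most `2 * M`. Hence `M` is
bounded below (`geometric_lower_bound`). Offline, one move to the apex over the last two requests
suffices (`opt_adversary_le`), which turns a ratio `r` into such an `M`.

The resulting bound on `r` holds for each `s > 1`. The quartic is its stationarity condition in `s`,
but the bound itself needs only `1 < s*`. The closed form is checked by Ferrari and Cardano. -/

/-! ### The quartic and its closed-form root -/

/-- The quartic has at most one positive root. -/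
lemma quartic_pos_root_unique {C s t : ℝ} (hs : 0 < s) (ht : 0 < t)
    (h₁ : s ^ 4 + 2 * C * s ^ 3 - 2 * s - 1 = 0) (h₂ : t ^ 4 + 2 * C * t ^ 3 - 2 * t - 1 = 0) :
    s = t := by
  have key : ∀ {x y : ℝ}, 0 < x → x < y → x ^ 4 + 2 * C * x ^ 3 - 2 * x - 1 = 0 →
      y ^ 4 + 2 * C * y ^ 3 - 2 * y - 1 = 0 → False := by
    intro x y hx hxy hx₀ hy₀
    have hy : 0 < y := hx.trans hxy
    -- Eliminating `C` between the two equations leaves `y - x` times a positive factor.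
    have e : (y - x) * (x ^ 3 * y ^ 3 + 2 * (x * y * (x + y)) + (x ^ 2 + x * y + y ^ 2)) = 0 := by
      linear_combination x ^ 3 * hy₀ - y ^ 3 * hx₀
    have : 0 < (y - x) * (x ^ 3 * y ^ 3 + 2 * (x * y * (x + y)) + (x ^ 2 + x * y + y ^ 2)) :=
      mul_pos (sub_pos.2 hxy) (by positivity)
    linarith
  rcases lt_trichotomy s t with h | h | h
  · exact (key hs h h₁ h₂).elim
  · exact h
  · exact (key ht h h₂ h₁).elim

/-- A positive root of the quartic with `C < 1` is larger than one. -/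
lemma one_lt_of_quartic_root {C s : ℝ} (hC : C < 1) (hs : 0 < s)
    (h : s ^ 4 + 2 * C * s ^ 3 - 2 * s - 1 = 0) : 1 < s := by
  by_contra! hs₁
  -- At `C = 1` the quartic is `(s - 1) * (s + 1) ^ 3`; in general `2 * (1 - C) * s ^ 3` is
  -- subtracted from it.
  have h₁ : (s - 1) * (s + 1) ^ 3 ≤ 0 :=
    mul_nonpos_of_nonpos_of_nonneg (by linarith) (by positivity)
  have h₂ : 0 < 2 * (1 - C) * s ^ 3 := mul_pos (by linarith) (by positivity)
  nlinarith

/-- Ferrari's solution of the quartic from a nonnegative root `y` of the resolvent cubic. -/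
lemma ferrari_root {C y r : ℝ} (hC₀ : -1 ≤ C) (hC₁ : C < 1) (hy : 0 ≤ y)
    (hcubic : y ^ 3 + 4 * (1 - C) * y - 4 * (1 - C ^ 2) = 0) (hr : 0 < r) (hr₂ : r ^ 2 = C ^ 2 + y) :
    let s := -(1 / 2) * C + 1 / 2 * r
      + 1 / 2 * √(2 * C ^ 2 - y + (16 - 8 * C ^ 3) / (4 * r))
    0 < s ∧ s ^ 4 + 2 * C * s ^ 3 - 2 * s - 1 = 0 := by
  intro s
  have hy₂ : y < 2 := by
    by_contra! h
    nlinarith [pow_le_pow_left₀ (by norm_num) h 3, mul_nonneg (sub_nonneg.2 hC₁.le) hy]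
  have hpos : 0 < 2 + C * y := by nlinarith
  -- The quartic splits as `(s² + (C - r) s + (y - k)/2) (s² + (C + r) s + (y + k)/2)` once `k r = 2
  -- + C y` and `k² = y² + 4`; the cubic makes these compatible. As `y < k`, the first factor has a
  -- positive root.
  obtain ⟨k, hk⟩ : ∃ k, k = (2 + C * y) / r := ⟨_, rfl⟩
  have hk₀ : 0 < k := hk ▸ div_pos hpos hr
  have hkr : k * r = 2 + C * y := by rw [hk]; field_simp
  have hk₂ : k ^ 2 = y ^ 2 + 4 := by
    have : (k ^ 2 - (y ^ 2 + 4)) * r ^ 2 = 0 := by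
      have : (k * r) ^ 2 = (2 + C * y) ^ 2 := by rw [hkr]
      linear_combination this - (y ^ 2 + 4) * hr₂ - hcubic
    have := (mul_eq_zero.1 this).resolve_right (by positivity)
    linarith
  have hyk : y < k := by nlinarith
  have hdisc : 2 * C ^ 2 - y + (16 - 8 * C ^ 3) / (4 * r) = (C - r) ^ 2 + 2 * (k - y) := by
    have h₁ : (16 - 8 * C ^ 3) / (4 * r) * r = 4 - 2 * C ^ 3 := by field_simp; ring
    have : (2 * C ^ 2 - y + (16 - 8 * C ^ 3) / (4 * r) - ((C - r) ^ 2 + 2 * (k - y))) * r = 0 := by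
      linear_combination h₁ - 2 * hkr - (r - 2 * C) * hr₂
    have := (mul_eq_zero.1 this).resolve_right hr.ne'
    linarith
  obtain ⟨d, hd⟩ : ∃ d, d = √(2 * C ^ 2 - y + (16 - 8 * C ^ 3) / (4 * r)) := ⟨_, rfl⟩
  have hd₂ : d ^ 2 = (C - r) ^ 2 + 2 * (k - y) := by
    rw [hd, hdisc, sq_sqrt (by nlinarith [sq_nonneg (C - r)])]
  have hd₀ : 0 ≤ d := hd ▸ sqrt_nonneg _
  have hs : s = (d - (C - r)) / 2 := by simp only [s, ← hd]; ring
  clear_value s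
  have hCd : C - r < d := by
    refine lt_of_pow_lt_pow_left₀ 2 hd₀ ?_
    linarith
  refine ⟨by rw [hs]; linarith, ?_⟩
  have hf : s ^ 2 + (C - r) * s + (y - k) / 2 = 0 := by
    rw [hs]; linear_combination hd₂ / 4
  have : (s ^ 2 + (C - r) * s + (y - k) / 2) * (s ^ 2 + (C + r) * s + (y + k) / 2) = 0 := by
    rw [hf, zero_mul]
  linear_combination this + s ^ 2 * hr₂ + s * hkr + hk₂ / 4

lemma cbrtTwo_pos : 0 < cbrtTwo := rpow_pos_of_pos two_pos _

lemma cbrtTwo_pow_three : cbrtTwo ^ 3 = 2 := by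
  rw [cbrtTwo, ← rpow_natCast, ← rpow_mul two_pos.le]; norm_num

section

variable {α : ℝ}

lemma cos_four_mul_lt_one (hα₀ : 0 < α) (hα₁ : α ≤ π / 4) : cos (4 * α) < 1 := by
  rw [← cos_zero]
  exact cos_lt_cos_of_nonneg_of_le_pi le_rfl (by linarith) (by linarith)

lemma sin_two_mul_sq (α : ℝ) : sin (2 * α) ^ 2 = (1 - cos (4 * α)) / 2 := by
  rw [sin_sq, show 4 * α = 2 * (2 * α) by ring, cos_two_mul (2 * α)]; ring

/-- The difference of the two cube-root terms in the closed form solves the resolvent cubic. -/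
lemma resolvent_root (hC : cos (4 * α) < 1) :
    ∃ y : ℝ, 0 ≤ y ∧ y ^ 3 + 4 * (1 - cos (4 * α)) * y - 4 * (1 - cos (4 * α) ^ 2) = 0 ∧
      y = hAux α / (3 * cbrtTwo) - 8 * cbrtTwo * sin (2 * α) ^ 2 / hAux α := by
  have hC₀ : -1 ≤ cos (4 * α) := neg_one_le_cos _
  set C := cos (4 * α) with hCdef
  obtain ⟨T, hT⟩ : ∃ T, T = √((108 - 108 * C ^ 2) ^ 2 - 4 * (12 * C - 12) ^ 3) := ⟨_, rfl⟩
  have hpow : 0 < (1 - C) ^ 3 := pow_pos (by linarith) 3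
  have hT₂ : T ^ 2 = (108 * (1 - C ^ 2)) ^ 2 + 4 * 1728 * (1 - C) ^ 3 := by
    rw [hT, sq_sqrt] <;> nlinarith [sq_nonneg (108 - 108 * C ^ 2)]
  have hT₀ : 0 < T := by
    rw [hT]; exact sqrt_pos.2 (by nlinarith [sq_nonneg (108 - 108 * C ^ 2)])
  have hA : 0 ≤ 1 - C ^ 2 := by nlinarith
  have hh : hAux α = (108 * (1 - C ^ 2) + T) ^ ((1 : ℝ) / 3) := by
    rw [hAux, ← hCdef, ← hT]; congr 1; ring
  have hh₀ : 0 < hAux α := hh ▸ rpow_pos_of_pos (by linarith) _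
  have hh₃ : hAux α ^ 3 = 108 * (1 - C ^ 2) + T := by
    rw [hh, ← rpow_natCast, ← rpow_mul (by linarith)]; norm_num
  have hk := cbrtTwo_pos
  have hk₃ := cbrtTwo_pow_three
  obtain ⟨p, hp⟩ : ∃ p, p = 8 * cbrtTwo * sin (2 * α) ^ 2 / hAux α := ⟨_, rfl⟩
  obtain ⟨q, hq⟩ : ∃ q, q = hAux α / (3 * cbrtTwo) := ⟨_, rfl⟩
  -- Cardano: `(q - p)³ + 3 p q (q - p) = q³ - p³`, so only `p q` and `q³ - p³` matter.
  have hpq : p * q = 4 * (1 - C) / 3 := by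
    rw [hp, hq, sin_two_mul_sq, ← hCdef]; field_simp; ring
  have hq₃ : q ^ 3 = (108 * (1 - C ^ 2) + T) / 54 := by
    rw [hq, div_pow, mul_pow, hk₃, hh₃]; norm_num
  have hp₃ : p ^ 3 = (T - 108 * (1 - C ^ 2)) / 54 := by
    have h₁ : p ^ 3 * (108 * (1 - C ^ 2) + T) = 128 * (1 - C) ^ 3 := by
      rw [← hh₃, hp, sin_two_mul_sq, ← hCdef, div_pow, div_mul_cancel₀ _ (by positivity)]
      linear_combination 64 * (1 - C) ^ 3 * hk₃
    have : (p ^ 3 - (T - 108 * (1 - C ^ 2)) / 54) * (108 * (1 - C ^ 2) + T) = 0 := by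
      linear_combination h₁ - hT₂ / 54
    have := (mul_eq_zero.1 this).resolve_right (by positivity)
    linarith
  refine ⟨q - p, ?_, ?_, by rw [hp, hq]⟩
  · have hq₀ : 0 ≤ q := hq ▸ by positivity
    refine sub_nonneg.2 (le_of_pow_le_pow_left₀ three_ne_zero hq₀ ?_)
    rw [hp₃, hq₃]; linarith
  · linear_combination hq₃ - hp₃ - 3 * (q - p) * hpq

lemma sStar_pos_root (hα₀ : 0 < α) (hα₁ : α ≤ π / 4) :
    0 < sStar α ∧
      sStar α ^ 4 + 2 * cos (4 * α) * sStar α ^ 3 - 2 * sStar α - 1 = 0 := by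
  have hC := cos_four_mul_lt_one hα₀ hα₁
  obtain ⟨y, hy₀, hcubic, hy⟩ := resolvent_root hC
  have hrad : radicand α = cos (4 * α) ^ 2 + y := by rw [radicand, hy]; ring
  have hpos : 0 < cos (4 * α) ^ 2 + y := by
    rcases hy₀.lt_or_eq with h | h
    · positivity
    -- If `y = 0`, the cubic forces `C ^ 2 = 1`.
    · rw [← h] at hcubic ⊢; nlinarith
  have := ferrari_root (neg_one_le_cos _) hC hy₀ hcubic (sqrt_pos.2 hpos) (sq_sqrt hpos.le)
  have e : sStar α = -(1 / 2) * cos (4 * α) + 1 / 2 * √(cos (4 * α) ^ 2 + y)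
      + 1 / 2 * √(2 * cos (4 * α) ^ 2 - y +
        (16 - 8 * cos (4 * α) ^ 3) / (4 * √(cos (4 * α) ^ 2 + y))) := by
    rw [sStar, hrad]; congr 3; rw [hy]; ring
  rw [e]; exact this

end

/-! ### Geometry of the plane -/

lemma dist_eq_sqrt (P Q : Plane) : dist P Q = √((P 0 - Q 0) ^ 2 + (P 1 - Q 1) ^ 2) := by
  rw [EuclideanSpace.dist_eq, Fin.sum_univ_two, Real.dist_eq, Real.dist_eq, sq_abs, sq_abs]

/-- A displacement is at least as long as its component along a unit vector. -/
lemma inner_le_dist {a b : ℝ} (hab : a ^ 2 + b ^ 2 = 1) (P Q : Plane) :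
    a * (P 0 - Q 0) + b * (P 1 - Q 1) ≤ dist P Q := by
  rw [dist_eq_sqrt]
  apply Real.le_sqrt_of_sq_le
  have : (a * (P 0 - Q 0) + b * (P 1 - Q 1)) ^ 2 + (a * (P 1 - Q 1) - b * (P 0 - Q 0)) ^ 2
      = (P 0 - Q 0) ^ 2 + (P 1 - Q 1) ^ 2 := by
    linear_combination ((P 0 - Q 0) ^ 2 + (P 1 - Q 1) ^ 2) * hab
  nlinarith [sq_nonneg (a * (P 1 - Q 1) - b * (P 0 - Q 0))]

lemma dist_le_pathLength (n : ℕ) (P : ℕ → Plane) : dist (P 0) (P n) ≤ pathLength n P :=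
  dist_le_range_sum_dist P n

/-! ### The adversary's sequence -/

lemma length_adversary (s : ℝ) (n : ℕ) : (adversary s n).length = n := by simp [adversary]

lemma take_adversary {s : ℝ} {n i : ℕ} (h : i ≤ n) :
    (adversary s n).take i = adversary s i := by
  simp [adversary, ← List.map_take, List.take_range, h]

lemma mem_adversary_iff {s x : ℝ} {n : ℕ} :
    x ∈ adversary s n ↔ ∃ k < n, x = 2 * (-s) ^ k := by
  simp [adversary, eq_comm]

lemma cost_adversary {α : ℝ} (A : OnlineAlgorithm α) (s : ℝ) (n : ℕ) :
    A.cost (adversary s n) = pathLength n fun i => A.pos (adversary s i) := by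
  rw [OnlineAlgorithm.cost, length_adversary]
  refine Finset.sum_congr rfl fun i hi => ?_
  have := Finset.mem_range.1 hi
  simp only [take_adversary this.le, take_adversary (Nat.succ_le_of_lt this)]

/-- Covering the `n + 1`-st request puts the drone in a half-plane that alternates sides. -/
lemma Covers.alternating_le {α s : ℝ} {P : Plane} {n : ℕ} (h : Covers α P (2 * (-s) ^ n)) :
    2 * s ^ n ≤ (-1) ^ n * P 0 + P 1 * tan α := by
  obtain ⟨-, h₁, h₂⟩ := h
  rw [neg_pow s] at h₁ h₂
  rcases neg_one_pow_eq_or ℝ n with e | e <;> rw [e] at h₁ h₂ ⊢ <;> linarith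

lemma bddBelow_costs (α : ℝ) (X : List ℝ) :
    BddBelow {c : ℝ | ∃ P : ℕ → Plane, IsSolution α X P ∧ c = pathLength X.length P} := by
  refine ⟨0, ?_⟩
  rintro _ ⟨P, -, rfl⟩
  exact Finset.sum_nonneg fun _ _ => dist_nonneg

/-- The position from which a single move serves the first `n` requests of the adversary. -/
noncomputable def targetPos (α s : ℝ) (n : ℕ) : Plane :=
  !₂[-((-1) ^ n * s ^ n * (s - 1) / s ^ 2), s ^ n * (s + 1) / (s ^ 2 * tan α)]

/-- The requests alternate in sign and grow, so the last two are the extremes; the target is the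
apex of the view triangle over them. For `n = 1` the second endpoint is the fictitious `-2 / s`,
which does no harm. -/
lemma covers_targetPos {α s x : ℝ} {n : ℕ} (hα : 0 < tan α) (hs : 1 < s)
    (hx : x ∈ (0 : ℝ) :: adversary s n) : Covers α (targetPos α s n) x := by
  have hs₀ : 0 < s := by linarith
  have e₀ : (targetPos α s n) 0 = -((-1) ^ n * s ^ n * (s - 1) / s ^ 2) := rfl
  have e₁ : (targetPos α s n) 1 = s ^ n * (s + 1) / (s ^ 2 * tan α) := rfl
  have e₂ : s ^ n * (s + 1) / (s ^ 2 * tan α) * tan α = s ^ n * (s + 1) / s ^ 2 := by field_simp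
  have hn : 0 < s ^ n / s ^ 2 := by positivity
  have f₁ : s ^ n * (s + 1) / s ^ 2 = s ^ n / s ^ 2 * (s + 1) := by ring
  have f₀ : (-1) ^ n * s ^ n * (s - 1) / s ^ 2 = (-1) ^ n * (s ^ n / s ^ 2 * (s - 1)) := by ring
  have hns : 0 < s ^ n / s ^ 2 * s := by positivity
  rw [Covers, e₀, e₁, e₂, f₀, f₁]
  refine ⟨by positivity, ?_⟩
  rcases List.mem_cons.1 hx with rfl | hx
  · rcases neg_one_pow_eq_or ℝ n with e | e <;> rw [e] <;> constructor <;> nlinarith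
  · obtain ⟨k, hk, rfl⟩ := mem_adversary_iff.1 hx
    have hk₀ : 0 < s ^ k := by positivity
    have hns₁ : s ^ n / s ^ 2 < s ^ n / s ^ 2 * s := lt_mul_of_one_lt_right hn hs
    rw [neg_pow s]
    clear e₀ e₁ e₂ f₀ f₁
    rcases (Nat.succ_le_of_lt hk).eq_or_lt with rfl | h
    · have hm : s ^ k = s ^ k.succ / s ^ 2 * s := by rw [pow_succ]; field_simp
      rw [pow_succ (-1 : ℝ)]
      rcases neg_one_pow_eq_or ℝ k with e | e <;> rw [e] <;> constructor <;> nlinarith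
    · have hm : s ^ k ≤ s ^ n / s ^ 2 := by
        rw [le_div_iff₀ (by positivity), ← pow_add]
        exact pow_le_pow_right₀ hs.le h
      rcases neg_one_pow_eq_or ℝ k with e | e <;>
        rcases neg_one_pow_eq_or ℝ n with e' | e' <;> rw [e, e'] <;> constructor <;> nlinarith

lemma isSolution_targetPos {α s : ℝ} (n : ℕ) (hα : 0 < tan α) (hs : 1 < s) :
    IsSolution α (adversary s n) fun i => if i = 0 then 0 else targetPos α s n := by
  refine ⟨if_pos rfl, fun i _ x hx => ?_⟩
  rcases eq_or_ne i 0 with rfl | hi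
  · have : x = 0 := by simpa using hx
    simp [this, Covers]
  · simp only [if_neg hi]
    refine covers_targetPos hα hs ?_
    rcases List.mem_cons.1 hx with rfl | hx
    · exact List.mem_cons_self
    · exact List.mem_cons_of_mem _ (List.mem_of_mem_take hx)

lemma opt_adversary_le {α s : ℝ} (n : ℕ) (hα : 0 < tan α) (hs : 1 < s) :
    opt α (adversary s (n + 1)) ≤ dist 0 (targetPos α s (n + 1)) := by
  refine csInf_le (bddBelow_costs _ _) ⟨_, isSolution_targetPos (n + 1) hα hs, ?_⟩
  rw [length_adversary, pathLength, Finset.sum_range_succ']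
  simp

lemma dist_targetPos {α s : ℝ} (n : ℕ) (hsin : 0 < sin α) (hcos : 0 < cos α) (hs : 1 < s) :
    dist 0 (targetPos α s n) =
      √(s ^ 2 + 1 + 2 * cos (2 * α) * s) / (sin α * s ^ 2) * s ^ n := by
  have hs₀ : 0 < s := by linarith
  have e₀ : (targetPos α s n) 0 = -((-1) ^ n * s ^ n * (s - 1) / s ^ 2) := rfl
  have e₁ : (targetPos α s n) 1 = s ^ n * (s + 1) / (s ^ 2 * tan α) := rfl
  have h1 : ((-1 : ℝ) ^ n) ^ 2 = 1 := by rw [← pow_mul, mul_comm, pow_mul]; norm_num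
  have key : s ^ 2 + 1 + 2 * cos (2 * α) * s = sin α ^ 2 * (s - 1) ^ 2 + cos α ^ 2 * (s + 1) ^ 2 := by
    rw [cos_two_mul]; linear_combination (-(s - 1) ^ 2) * sin_sq_add_cos_sq α
  rw [dist_eq_sqrt, e₀, e₁, tan_eq_sin_div_cos, sqrt_eq_iff_eq_sq (by positivity) (by positivity),
    mul_pow, div_pow, sq_sqrt (by rw [key]; positivity), key]
  simp only [PiLp.zero_apply]
  field_simp
  linear_combination (s ^ (n * 2) * sin α ^ 2 * (s - 1) ^ 2) * h1

lemma opt_adversary_pos {α s : ℝ} (n : ℕ) (hα : 0 < tan α) (hs : 1 < s) :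
    0 < opt α (adversary s (n + 1)) := by
  have hK : 0 < 2 / (1 + tan α) := by positivity
  -- A solution must be exhibited, since `sInf ∅ = 0`; the bound comes from covering the first
  -- request, `2`.
  refine hK.trans_le (le_csInf ⟨_, _, isSolution_targetPos (n + 1) hα hs, rfl⟩ ?_)
  rintro _ ⟨P, ⟨hP₀, hP⟩, rfl⟩
  rw [length_adversary] at hP ⊢
  refine le_trans ?_ (dist_le_pathLength _ P)
  have h := hP (n + 1) le_rfl 2 (List.mem_cons_of_mem _ ?_)
  · obtain ⟨-, -, h⟩ := h
    have h₀ := inner_le_dist (a := 1) (b := 0) (by norm_num) (P (n + 1)) (P 0)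
    have h₁ := inner_le_dist (a := 0) (b := 1) (by norm_num) (P (n + 1)) (P 0)
    rw [dist_comm] at h₀ h₁
    rw [div_le_iff₀ (by positivity)]
    simp only [hP₀, PiLp.zero_apply, sub_zero] at h₀ h₁ ⊢
    nlinarith
  · rw [take_adversary le_rfl]
    exact mem_adversary_iff.2 ⟨0, n.succ_pos, by simp⟩

/-! ### The lower bound -/

/-- A sequence with increments at least `δ > 0` is not bounded above. -/
lemma not_bddAbove_of_add_le {f : ℕ → ℝ} {δ M : ℝ} (hδ : 0 < δ) (h : ∀ n, f n + δ ≤ f (n + 1))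
    (hM : ∀ n, f n ≤ M) : False := by
  have h₁ : ∀ n : ℕ, f 0 + n * δ ≤ f n := by
    intro n
    induction n with
    | zero => simp
    | succ n ih => push_cast; linarith [h n]
  obtain ⟨n, hn⟩ := exists_nat_gt ((M - f 0) / δ)
  rw [div_lt_iff₀ hδ] at hn
  linarith [h₁ n, hM n]

/-- The lower bound forced by the adversary's sequence with ratio `s`, for paths whose length is
bounded by a geometric sequence. -/
lemma geometric_lower_bound {s τ a b m M : ℝ} {Q : ℕ → Plane} (hs : 1 < s)
    (hab : a ^ 2 + b ^ 2 = 1) (ha : a * (s + 1) = m) (hb : b * (s - 1) = m * τ) (hm : 0 ≤ m)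
    (hQ₀ : Q 0 = 0)
    (hQ : ∀ n, 2 * s ^ n ≤ (-1) ^ n * Q (n + 1) 0 + Q (n + 1) 1 * τ)
    (hM : ∀ n, pathLength (n + 1) Q ≤ M * s ^ (n + 1)) : 2 * m ≤ s * (s - 1) * M := by
  have hs₀ : 0 < s := by linarith
  by_contra! hlt
  have hε : ∀ n : ℕ, ((-1 : ℝ) ^ n) ^ 2 = 1 := fun n => by
    rw [← pow_mul, mul_comm, pow_mul]; norm_num
  obtain ⟨W, hW⟩ : ∃ W : ℕ → ℝ, ∀ n, W n = pathLength (n + 1) Q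
      - (a * ((-1) ^ n * Q (n + 1) 0) + b * Q (n + 1) 1) := ⟨_, fun _ => rfl⟩
  refine not_bddAbove_of_add_le (f := fun n => W n / s ^ (n + 1)) (M := 2 * M)
    (δ := (2 * m - s * (s - 1) * M) / s ^ 2) (by apply div_pos <;> [linarith; positivity]) ?_ ?_
  · intro n
    have hstep := inner_le_dist (a := a * (-1) ^ (n + 1)) (b := b)
      (by rw [mul_pow, hε, mul_one, hab]) (Q (n + 2)) (Q (n + 1))
    rw [dist_comm] at hstep
    have hlen : pathLength (n + 2) Q = pathLength (n + 1) Q + dist (Q (n + 1)) (Q (n + 2)) :=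
      Finset.sum_range_succ _ _
    have h₁ := mul_le_mul_of_nonneg_left (hQ n) hm
    have h₂ := mul_le_mul_of_nonneg_left (hM n) (sub_nonneg.2 hs.le)
    have e₁ : a * (s + 1) * ((-1) ^ n * Q (n + 1) 0) = m * ((-1) ^ n * Q (n + 1) 0) := by rw [ha]
    have e₂ : b * (s - 1) * Q (n + 1) 1 = m * τ * Q (n + 1) 1 := by rw [hb]
    -- The reflection flips the sign of the horizontal term, so the terms in `Q (n + 1)` have
    -- coefficients `a * (s + 1)` and `b * (s - 1)`: exactly `m` times the half-plane's normal.
    have key : s * W n + (2 * m - s * (s - 1) * M) * s ^ n ≤ W (n + 1) := by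
      rw [hW, hW, hlen]
      rw [pow_succ (-1 : ℝ)] at hstep ⊢
      rw [pow_succ s] at h₂
      linarith
    have e : W n / s ^ (n + 1) + (2 * m - s * (s - 1) * M) / s ^ 2
        = (s * W n + (2 * m - s * (s - 1) * M) * s ^ n) / s ^ (n + 2) := by
      field_simp
      ring
    simp only [e]
    gcongr
  · intro n
    have h₁ := inner_le_dist (a := -(a * (-1) ^ n)) (b := -b)
      (by rw [neg_sq, neg_sq, mul_pow, hε, mul_one, hab]) (Q (n + 1)) (Q 0)
    have h₂ := dist_le_pathLength (n + 1) Q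
    rw [dist_comm] at h₂
    rw [hQ₀] at h₁ h₂
    simp only [PiLp.zero_apply, sub_zero] at h₁
    rw [div_le_iff₀ (by positivity), hW]
    linarith [hM n]

/-- The lower bound forced by the adversary's sequence with ratio `s`. -/
lemma lower_bound {α s r : ℝ} (A : OnlineAlgorithm α) (hsin : 0 < sin α) (hcos : 0 < cos α)
    (hs : 1 < s)
    (hr : ∀ n, A.cost (adversary s (n + 1)) ≤ r * opt α (adversary s (n + 1))) :
    2 * sin α * cos α * s * (1 + s) /
      (√(s ^ 2 + 1 - 2 * cos (2 * α) * s) * √(s ^ 2 + 1 + 2 * cos (2 * α) * s)) ≤ r := by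
  have hs₀ : 0 < s := by linarith
  have hs₁ : 0 < s - 1 := by linarith
  have hα : 0 < tan α := tan_eq_sin_div_cos α ▸ div_pos hsin hcos
  have hD : s ^ 2 + 1 - 2 * cos (2 * α) * s
      = cos α ^ 2 * (s - 1) ^ 2 + sin α ^ 2 * (s + 1) ^ 2 := by
    rw [cos_two_mul]; linear_combination (-(s + 1) ^ 2) * sin_sq_add_cos_sq α
  have hE : s ^ 2 + 1 + 2 * cos (2 * α) * s
      = sin α ^ 2 * (s - 1) ^ 2 + cos α ^ 2 * (s + 1) ^ 2 := by
    rw [cos_two_mul]; linear_combination (-(s - 1) ^ 2) * sin_sq_add_cos_sq α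
  have hd : 0 < √(s ^ 2 + 1 - 2 * cos (2 * α) * s) := sqrt_pos.2 (by rw [hD]; positivity)
  have hd₂ : √(s ^ 2 + 1 - 2 * cos (2 * α) * s) ^ 2 = _ :=
    (sq_sqrt (by rw [hD]; positivity)).trans hD
  have he : 0 < √(s ^ 2 + 1 + 2 * cos (2 * α) * s) := sqrt_pos.2 (by rw [hE]; positivity)
  have hopt : ∀ n, opt α (adversary s (n + 1)) ≤
      √(s ^ 2 + 1 + 2 * cos (2 * α) * s) / (sin α * s ^ 2) * s ^ (n + 1) := fun n =>
    (opt_adversary_le n hα hs).trans_eq (dist_targetPos (n + 1) hsin hcos hs)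
  set d := √(s ^ 2 + 1 - 2 * cos (2 * α) * s)
  set e := √(s ^ 2 + 1 + 2 * cos (2 * α) * s)
  have hr₀ : 0 ≤ r := by
    have : 0 ≤ A.cost (adversary s (0 + 1)) := by
      rw [cost_adversary]; exact Finset.sum_nonneg (fun _ _ => dist_nonneg)
    exact nonneg_of_mul_nonneg_left (this.trans (hr 0)) (opt_adversary_pos 0 hα hs)
  -- The conditions on `a`, `b`, `m` fix the direction `(cos α (s - 1), sin α (s + 1))`, whose norm
  -- is `d`.
  have := geometric_lower_bound (s := s) (τ := tan α) (a := cos α * (s - 1) / d)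
    (b := sin α * (s + 1) / d) (m := cos α * (s - 1) * (s + 1) / d)
    (M := r * (e / (sin α * s ^ 2))) (Q := fun i => A.pos (adversary s i)) hs
    (by rw [div_pow, div_pow, ← add_div, div_eq_one_iff_eq (by positivity), hd₂]; ring)
    (by ring) (by rw [tan_eq_sin_div_cos]; field_simp) (by positivity)
    A.pos_nil (fun n => (A.covers _ _ (List.mem_cons_of_mem _
      (mem_adversary_iff.2 ⟨n, n.lt_succ_self, rfl⟩))).alternating_le)
    (fun n => by
      rw [← cost_adversary, mul_assoc]
      exact (hr n).trans (mul_le_mul_of_nonneg_left (hopt n) hr₀))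
  rw [div_le_iff₀ (by positivity)]
  have h₃ := mul_le_mul_of_nonneg_right this (by positivity : 0 ≤ d * (sin α * s))
  refine le_of_mul_le_mul_left ?_ hs₁
  have e₁ : 2 * (cos α * (s - 1) * (s + 1) / d) * (d * (sin α * s))
      = (s - 1) * (2 * sin α * cos α * s * (1 + s)) := by field_simp; ring
  have e₂ : s * (s - 1) * (r * (e / (sin α * s ^ 2))) * (d * (sin α * s))
      = (s - 1) * (r * (d * e)) := by field_simp
  rwa [e₁, e₂] at h₃

/-- The radicand is twice the difference of squares `(s² + 1)² - (2 s cos 2α)²`. -/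
lemma rhoStar_eq {α : ℝ} (hsin : 0 < sin α) (hcos : 0 < cos α) :
    rhoStar α = 2 * sin α * cos α * sStar α * (1 + sStar α) /
      (√(sStar α ^ 2 + 1 - 2 * cos (2 * α) * sStar α) *
        √(sStar α ^ 2 + 1 + 2 * cos (2 * α) * sStar α)) := by
  have h₄ : cos (4 * α) = 2 * cos (2 * α) ^ 2 - 1 := by
    rw [← cos_two_mul]; congr 1; ring
  have h₁ : 1 - cos (4 * α) = (2 * sin α * cos α) ^ 2 * 2 := by
    rw [← sin_two_mul, h₄, sin_sq]; ring
  have h₂ : 0 ≤ sStar α ^ 2 + 1 - 2 * cos (2 * α) * sStar α := by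
    nlinarith [sq_nonneg (sStar α - cos (2 * α)), cos_sq_le_one (2 * α)]
  have h₃ : 2 * (1 + sStar α ^ 4) - 4 * sStar α ^ 2 * cos (4 * α)
      = (sStar α ^ 2 + 1 - 2 * cos (2 * α) * sStar α) *
        (sStar α ^ 2 + 1 + 2 * cos (2 * α) * sStar α) * 2 := by
    rw [h₄]; ring
  rw [rhoStar, h₃, h₁, sqrt_mul' _ two_pos.le, sqrt_mul' _ two_pos.le, sqrt_mul h₂,
    sqrt_sq (by positivity), ← mul_assoc, mul_div_mul_right _ _ (by positivity)]
  congr 1; ring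

end DroneCoverage

theorem mainTheorem2 (α : ℝ) (hα₀ : 0 < α) (hα₁ : α ≤ Real.pi / 4) :
    -- `s*` is larger than one, and it is the only root at least one of the quartic
    (1 < DroneCoverage.sStar α ∧
      ∀ s : ℝ, 1 ≤ s →
        (s ^ 4 + 2 * Real.cos (4 * α) * s ^ 3 - 2 * s - 1 = 0 ↔ s = DroneCoverage.sStar α)) ∧
    ∀ A : DroneCoverage.OnlineAlgorithm α,
      -- the lower bound on the competitive ratio
      (DroneCoverage.rhoStar α : EReal) ≤ A.competitiveRatio ∧
      -- the adversary's sequence with parameter `s*` forces it, when stopped at a suitable time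
      (DroneCoverage.rhoStar α : EReal) ≤
        A.competitiveRatioOn
          (Set.range fun n : ℕ => DroneCoverage.adversary (DroneCoverage.sStar α) n) := by
  obtain ⟨hpos, hroot⟩ := DroneCoverage.sStar_pos_root hα₀ hα₁
  have hC := DroneCoverage.cos_four_mul_lt_one hα₀ hα₁
  have hs := DroneCoverage.one_lt_of_quartic_root hC hpos hroot
  refine ⟨⟨hs, fun s hs₁ => ⟨fun h =>
    DroneCoverage.quartic_pos_root_unique (by linarith) hpos h hroot, fun h => h ▸ hroot⟩⟩, ?_⟩
  intro A
  have hsin : 0 < Real.sin α := Real.sin_pos_of_pos_of_lt_pi hα₀ (by linarith [Real.pi_pos])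
  have hcos : 0 < Real.cos α :=
    Real.cos_pos_of_mem_Ioo ⟨by linarith [Real.pi_pos], by linarith [Real.pi_pos]⟩
  have hα : 0 < Real.tan α := Real.tan_eq_sin_div_cos α ▸ div_pos hsin hcos
  have main : (DroneCoverage.rhoStar α : EReal) ≤ A.competitiveRatioOn
      (Set.range fun n : ℕ => DroneCoverage.adversary (DroneCoverage.sStar α) n) := by
    by_contra! hlt
    obtain ⟨r, hr₁, hr₂⟩ := EReal.lt_iff_exists_real_btwn.1 hlt
    refine (EReal.coe_lt_coe_iff.1 hr₂).not_ge ?_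
    rw [DroneCoverage.rhoStar_eq hsin hcos]
    refine DroneCoverage.lower_bound A hsin hcos hs fun n => ?_
    -- The index `n + 1` skips the empty input, whose optimum is zero.
    have hopt := DroneCoverage.opt_adversary_pos n hα hs
    rw [← div_le_iff₀ hopt, ← EReal.coe_le_coe_iff]
    refine le_trans ?_ hr₁.le
    exact le_iSup₂_of_le (f := fun X (_ : X ∈ Set.range fun n : ℕ =>
      DroneCoverage.adversary (DroneCoverage.sStar α) n) => ⨆ _ : 0 < DroneCoverage.opt α X,
        ((A.cost X / DroneCoverage.opt α X : ℝ) : EReal)) _ ⟨n + 1, rfl⟩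
      (le_iSup_of_le hopt le_rfl)
  exact ⟨main.trans (biSup_mono fun _ _ => Set.mem_univ _), main⟩
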